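/- Let $K$ be known and fixed, let $\Theta^*\in[0,1]^{K\times K}$ be a symmetric matrix and $\alpha$ a probability vector of length $K$ such that - **A1.** for all $k\neq k'$ there is $l$ with $\Theta^*_{kl}\neq\Theta^*_{k'l}$ or $\Theta^*_{lk}\neq\Theta^*_{lk'}$; - **A2.** there is $\zeta\in(0,1)$ with $\Theta^*_{kl}\in[\zeta,1-\zeta]$ for all $k,l$; - **A3.** there is $\gamma\in(0,1/K)$ with $\alpha_k\in[\gamma,1-\gamma]$ for all $k$. For each $N$ let $A=A^{(N)}\in\{0,1\}^{N\times N}$ be the adjacency matrix of an undirected graph without self loops drawn from the Bernoulli stochastic block model with these parameters: the labels $Z_1,\dots,Z_N$ are i.i.d. with $\mathbb P(Z_i=k)=\alpha_k$ and, given $Z$, the entries $A_{ij}=A_{ji}$, $i<j$, are independent with $A_{ij}\sim\mathcal B(\Theta^*_{Z_iZ_j})$. Let $$L_p(T,\Theta)=\sum_{i\neq j}\sum_{k,l}-\log p(A_{ij}\mid\Theta_{kl})\,T_{ik}T_{jl},\qquad p(1\mid\theta)=\theta,\quad p(0\mid\theta)=1-\theta,$$ with $-\log 0=\infty$ and $\infty\cdot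 0=0$, let $\mathcal U_K(\mathbf 1_N/N)$ be the set of nonnegative $N\times K$ matrices whose rows all sum to $1/N$, and let $\mathcal S\subseteq[0,1]^{K\times K}$ be a closed parameter set containing $\Theta^*$ (for instance $\mathcal S=[0,1]^{K\times K}$). Then an unregularized srGW estimator $$(\widehat T,\widehat\Theta)\in\operatorname*{argmin}_{T\in\mathcal U_K(\mathbf 1_N/N),\ \Theta\in\mathcal S}L_p(T,\Theta)$$ exists, and for every choice of such minimizers $\widehat\Theta$ converges in probability to $\Theta^*$ as $N\to\infty$, up to label switching: there are (random) permutations $\sigma_N$ of $\{1,\dots,K\}$ such that $$\bigl(\widehat\Theta_{\sigma_N(k)\sigma_N(l)}\bigr)_{k,l}\ \xrightarrow[N\to\infty]{\ \mathbb P\ }\ \Theta^*.$$ -/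

import Mathlib

open MeasureTheory ProbabilityTheory Filter Topology
open scoped ENNReal

/-- The random labels `Z` and the random binary adjacency matrix `A` on `N` nodes follow a Bernoulli
stochastic block model (undirected graph, no self loops) with cluster proportions `α` and
connectivity matrix `Θ`.  As `A` is symmetric and `edges_law` holds for every ordered pair `i ≠ j`,
the matrix `Θ` is symmetric as soon as `2 ≤ N` and all proportions are positive. -/
structure IsBernoulliSBM {Ω : Type*} [MeasurableSpace Ω] (P : Measure Ω) {N K : ℕ}
    (Θ : Matrix (Fin K) (Fin K) ℝ) (α : Fin K → ℝ)
    (Z : Ω → Fin N → Fin K) (A : Ω → Matrix (Fin N) (Fin N) Bool) : Prop where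
  measurable_labels : ∀ i, Measurable fun ω => Z ω i
  measurable_edges : ∀ i j, Measurable fun ω => A ω i j
  /-- undirected graph -/
  symm : ∀ ω i j, A ω i j = A ω j i
  /-- no self loops -/
  no_loops : ∀ ω i, A ω i i = false
  /-- the labels are independent -/
  labels_indep : iIndepFun (fun (i : Fin N) (ω : Ω) => Z ω i) P
  /-- each label is categorical with weights `α` -/
  labels_law : ∀ i k, P {ω | Z ω i = k} = ENNReal.ofReal (α k)
  /-- given the labels, the edges are independent -/
  edges_indep : ∀ z : Fin N → Fin K, P {ω | Z ω = z} ≠ 0 →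
    iIndepFun (fun (e : {e : Fin N × Fin N // e.1 < e.2}) (ω : Ω) => A ω e.1.1 e.1.2)
      (cond P {ω | Z ω = z})
  /-- given the labels, `A i j` is Bernoulli with parameter `Θ (Z i) (Z j)` -/
  edges_law : ∀ z : Fin N → Fin K, P {ω | Z ω = z} ≠ 0 → ∀ i j, i ≠ j →
    cond P {ω | Z ω = z} {ω | A ω i j = true} = ENNReal.ofReal (Θ (z i) (z j))

/-- No two clusters have the same connectivity profile. -/
def DistinctClusters {K : ℕ} (Θ : Matrix (Fin K) (Fin K) ℝ) : Prop :=
  ∀ k k', k ≠ k' → ∃ l, Θ k l ≠ Θ k' l ∨ Θ l k ≠ Θ l k'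

/-- The connection probabilities are bounded away from `0` and `1`. -/
def InteriorConnectivity {K : ℕ} (Θ : Matrix (Fin K) (Fin K) ℝ) : Prop :=
  ∃ ζ ∈ Set.Ioo (0 : ℝ) 1, ∀ k l, Θ k l ∈ Set.Icc ζ (1 - ζ)

/-- The cluster proportions are bounded away from `0` and `1`. -/
def NondegenerateProportions {K : ℕ} (α : Fin K → ℝ) : Prop :=
  ∃ γ ∈ Set.Ioo (0 : ℝ) (1 / (K : ℝ)), ∀ k, α k ∈ Set.Icc γ (1 - γ)

/-- The Bernoulli probability mass function `p(a | θ)`. -/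
def bernoulliMass (a : Bool) (θ : ℝ) : ℝ := if a = true then θ else 1 - θ

/-- The inner loss `-log p(a | θ)` for `θ ∈ [0, 1]`, with values in `[0, ∞]` and `-log 0 = ∞`. -/
noncomputable def negLogLik (a : Bool) (θ : ℝ) : ℝ≥0∞ :=
  if bernoulliMass a θ ≤ 0 then ⊤ else ENNReal.ofReal (-Real.log (bernoulliMass a θ))

/-- The admissible transport plans `𝒰_K(1_N / N)`: nonnegative `N × K` matrices all of whose rows
sum to `1 / N`. -/
def transportPlans (N K : ℕ) : Set (Matrix (Fin N) (Fin K) ℝ) :=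
  {T | (∀ i k, 0 ≤ T i k) ∧ ∀ i, ∑ k, T i k = 1 / (N : ℝ)}

/-- The unregularized Gromov-Wasserstein loss
`L_p(T, Θ) = ∑_{i,j,k,l} -log p(A_ij | Θ_kl) T_ik T_jl`, where, the graph having no self loops,
`log p(A_ii | Θ_kl) = 0` by convention.  In `[0, ∞]` one has `∞ * 0 = 0`. -/
noncomputable def gwLoss {N K : ℕ} (A : Matrix (Fin N) (Fin N) Bool)
    (T : Matrix (Fin N) (Fin K) ℝ) (Θ : Matrix (Fin K) (Fin K) ℝ) : ℝ≥0∞ :=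
  ∑ i, ∑ j, ∑ k, ∑ l,
    (if i = j then 0 else negLogLik (A i j) (Θ k l)) * ENNReal.ofReal (T i k * T j l)

/-- `(T, Θ)` is an srGW estimator for `A`: it minimizes the loss jointly over all transport plans
and all connectivity matrices in the parameter set `S`. -/
def IsSrGWEstimator {N K : ℕ} (S : Set (Matrix (Fin K) (Fin K) ℝ))
    (A : Matrix (Fin N) (Fin N) Bool)
    (T : Matrix (Fin N) (Fin K) ℝ) (Θ : Matrix (Fin K) (Fin K) ℝ) : Prop :=
  T ∈ transportPlans N K ∧ Θ ∈ S ∧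
    ∀ T' ∈ transportPlans N K, ∀ Θ' ∈ S, gwLoss A T Θ ≤ gwLoss A T' Θ'

/-! The log loss is unbounded, so probabilities are truncated below at a small `ε`. This only lowers
the loss, and leaves it unchanged at `Θstar` once `ε ≤ ζ`; hence a minimizer has truncated loss at
most that of the true labels with `Θstar`.

Cross entropy is affine in the edge variable, so the truncated loss is its mean given the labels
plus bilinear forms in the centred adjacency matrix (`truncLoss_eq`). These are bounded for all
plans at once by the Gram energy (`bilin_pow_four_le`), whose mean is `O(N ^ 3)` by independence of
the edges (`integral_gramEnergy_le`), negligible against `N ^ 4`.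

The excess mean loss is therefore small, and a Hellinger bound turns it into a small squared
distance between parameters, averaged over the plan (`weighted_sq_dist_le`). By pigeonhole every
large true cluster puts much of its mass in one column; along these columns the parameters nearly
agree, and distinctness of the profiles makes the choice of columns a permutation
(`exists_perm_close`). Probability enters only through Markov for the noise and Chebyshev for the
cluster sizes.

Existence is lower semicontinuity on a compact set. -/

/-! ### Truncated cross entropy and its Hellinger gap -/

/-- The cross entropy of a Bernoulli law with mean `a`, both probabilities being truncated
below at `ε`. -/
noncomputable def truncCrossEntropy (ε a θ : ℝ) : ℝ :=
  -(a * Real.log (max θ ε) + (1 - a) * Real.log (max (1 - θ) ε))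

/-- The indicator of an edge. -/
def edgeIndicator (a : Bool) : ℝ := if a = true then 1 else 0

theorem edgeIndicator_mem (a : Bool) : edgeIndicator a ∈ Set.Icc (0 : ℝ) 1 := by
  cases a <;> simp [edgeIndicator]

theorem neg_log_max_mem {ε x : ℝ} (hε : 0 < ε) (hε1 : ε ≤ 1) (hx : x ≤ 1) :
    -Real.log (max x ε) ∈ Set.Icc 0 (-Real.log ε) := by
  have h : ε ≤ max x ε := le_max_right _ _
  refine ⟨?_, ?_⟩
  · have := Real.log_nonpos (hε.le.trans h) (max_le hx hε1)
    linarith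
  · have := Real.log_le_log hε h
    linarith

theorem truncCrossEntropy_mem {ε a θ : ℝ} (hε : 0 < ε) (hε1 : ε ≤ 1)
    (ha : a ∈ Set.Icc (0 : ℝ) 1) (hθ : θ ∈ Set.Icc (0 : ℝ) 1) :
    truncCrossEntropy ε a θ ∈ Set.Icc 0 (-Real.log ε) := by
  obtain ⟨h1, h2⟩ := neg_log_max_mem hε hε1 hθ.2
  obtain ⟨h3, h4⟩ := neg_log_max_mem (x := 1 - θ) hε hε1 (by linarith [hθ.1])
  obtain ⟨ha0, ha1⟩ := ha
  unfold truncCrossEntropy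
  constructor
  · nlinarith
  · nlinarith

theorem truncCrossEntropy_le_negLogLik (ε θ : ℝ) (a : Bool) :
    ENNReal.ofReal (truncCrossEntropy ε (edgeIndicator a) θ) ≤ negLogLik a θ := by
  unfold negLogLik
  split_ifs with h
  · exact le_top
  · refine ENNReal.ofReal_le_ofReal ?_
    have key : ∀ x, 0 < x → -Real.log (max x ε) ≤ -Real.log x := fun x hx =>
      neg_le_neg (Real.log_le_log hx (le_max_left _ _))
    cases a
    · simpa [bernoulliMass, edgeIndicator, truncCrossEntropy] using
        key (1 - θ) (by simpa [bernoulliMass] using h)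
    · simpa [bernoulliMass, edgeIndicator, truncCrossEntropy] using
        key θ (by simpa [bernoulliMass] using h)

theorem negLogLik_eq_truncCrossEntropy {ε θ : ℝ} (hε : 0 < ε)
    (hθ : θ ∈ Set.Icc ε (1 - ε)) (a : Bool) :
    negLogLik a θ = ENNReal.ofReal (truncCrossEntropy ε (edgeIndicator a) θ) := by
  obtain ⟨h1, h2⟩ := hθ
  have h3 : ε ≤ 1 - θ := by linarith
  unfold negLogLik
  rw [if_neg]
  · cases a <;> simp [bernoulliMass, edgeIndicator, truncCrossEntropy, h1, h3]
  · cases a <;> simp [bernoulliMass] <;> linarith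

/-- This is `log x ≤ x - 1` at `x = √q / √p`. The term `p - q` is kept because truncated
probabilities need not sum to one. -/
theorem mul_log_div_ge {p q : ℝ} (hp : 0 < p) (hq : 0 < q) :
    p * (Real.log p - Real.log q) ≥ (√p - √q) ^ 2 + p - q := by
  have h1 : Real.log (√q / √p) ≤ √q / √p - 1 := Real.log_le_sub_one_of_pos (by positivity)
  rw [Real.log_div (by positivity) (by positivity), Real.log_sqrt hq.le, Real.log_sqrt hp.le] at h1
  have h2 : p * (√q / √p) = √p * √q := by
    have := Real.mul_self_sqrt hp.le
    field_simp
    nlinarith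
  have h3 := mul_le_mul_of_nonneg_left h1 hp.le
  nlinarith [Real.sq_sqrt hp.le, Real.sq_sqrt hq.le]

theorem sq_sub_le_sqrt {p q : ℝ} (hp : 0 ≤ p) (hq : 0 ≤ q) (hp1 : p ≤ 1) (hq1 : q ≤ 1) :
    (p - q) ^ 2 / 4 ≤ (√p - √q) ^ 2 := by
  have h : p - q = (√p - √q) * (√p + √q) := by
    nlinarith [Real.sq_sqrt hp, Real.sq_sqrt hq]
  have h2 : (√p + √q) ^ 2 ≤ 4 := by
    nlinarith [Real.sqrt_nonneg p, Real.sqrt_nonneg q, Real.sqrt_le_one.2 hp1,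
      Real.sqrt_le_one.2 hq1]
  rw [h, mul_pow]
  nlinarith [sq_nonneg (√p - √q)]

/-- Truncated cross entropy separates parameters, up to the truncation error. -/
theorem truncCrossEntropy_gap {ε p θ : ℝ} (hε : 0 < ε) (hp : p ∈ Set.Icc ε (1 - ε))
    (hθ : θ ∈ Set.Icc (0 : ℝ) 1) :
    (p - max θ ε) ^ 2 / 4 - ε ≤ truncCrossEntropy ε p θ - truncCrossEntropy ε p p := by
  obtain ⟨hp0, hp1⟩ := hp
  obtain ⟨hθ0, hθ1⟩ := hθ
  have hp2 : ε ≤ 1 - p := by linarith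
  unfold truncCrossEntropy
  rw [max_eq_left hp0, max_eq_left hp2]
  have a1 := mul_log_div_ge (p := p) (q := max θ ε) (by linarith) (lt_max_of_lt_right hε)
  have a2 := mul_log_div_ge (p := 1 - p) (q := max (1 - θ) ε) (by linarith)
    (lt_max_of_lt_right hε)
  have a3 := sq_sub_le_sqrt (p := p) (q := max θ ε) (by linarith)
    (le_max_of_le_left hθ0) (by linarith) (max_le hθ1 (by linarith))
  -- The truncated masses exceed total mass one by at most `ε`; this is the only source of the error
  -- `ε`.
  have a4 : max θ ε + max (1 - θ) ε ≤ 1 + ε := by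
    rcases le_total θ ε with h | h <;> rcases le_total (1 - θ) ε with h' | h' <;>
      simp [h, h'] <;> linarith
  have a5 := sq_nonneg (√(1 - p) - √(max (1 - θ) ε))
  nlinarith

/-! ### Uniform bounds for bilinear forms -/

/-- The sum of the squared entries of the Gram matrix `Mᵀ M`. -/
def gramEnergy {N : ℕ} (M : Matrix (Fin N) (Fin N) ℝ) : ℝ :=
  ∑ j, ∑ j', (∑ i, M i j * M i j') ^ 2

theorem gramEnergy_nonneg {N : ℕ} (M : Matrix (Fin N) (Fin N) ℝ) : 0 ≤ gramEnergy M := by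
  unfold gramEnergy; positivity

/-- Cauchy-Schwarz twice, first to remove `x`, then to remove `y ⊗ y`. What remains depends on `M`
only, so no union bound over plans is needed. -/
theorem bilin_pow_four_le {N : ℕ} (M : Matrix (Fin N) (Fin N) ℝ) {x y : Fin N → ℝ} {c : ℝ}
    (hx : ∀ i, |x i| ≤ c) (hy : ∀ i, |y i| ≤ c) :
    (∑ i, ∑ j, x i * y j * M i j) ^ 4 ≤ (N * c ^ 2) ^ 4 * gramEnergy M := by
  have hsq : ∀ {z : Fin N → ℝ}, (∀ i, |z i| ≤ c) → ∑ i, z i ^ 2 ≤ N * c ^ 2 := fun {z} hz => by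
    calc ∑ i, z i ^ 2 ≤ ∑ _i : Fin N, c ^ 2 := Finset.sum_le_sum fun i _ => by
          rw [← sq_abs]; exact pow_le_pow_left₀ (abs_nonneg _) (hz i) 2
      _ = _ := by simp
  set s := (N : ℝ) * c ^ 2
  have hs : 0 ≤ s := by positivity
  have e1 : ∑ i, ∑ j, x i * y j * M i j = ∑ i, x i * ∑ j, M i j * y j := by
    refine Finset.sum_congr rfl fun i _ => ?_
    rw [Finset.mul_sum]; exact Finset.sum_congr rfl fun j _ => by ring
  set q := ∑ i, (∑ j, M i j * y j) ^ 2 with hq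
  have hq0 : 0 ≤ q := by positivity
  have h1 : (∑ i, ∑ j, x i * y j * M i j) ^ 2 ≤ s * q := by
    rw [e1]
    exact (Finset.sum_mul_sq_le_sq_mul_sq _ _ _).trans
      (mul_le_mul_of_nonneg_right (hsq hx) hq0)
  have e2 : q = ∑ p : Fin N × Fin N, (y p.1 * y p.2) * ∑ i, M i p.1 * M i p.2 := by
    rw [hq, Fintype.sum_prod_type]
    simp_rw [sq, Finset.sum_mul_sum, Finset.mul_sum]
    rw [Finset.sum_comm]
    refine Finset.sum_congr rfl fun j _ => ?_
    rw [Finset.sum_comm]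
    exact Finset.sum_congr rfl fun j' _ => Finset.sum_congr rfl fun i _ => by ring
  have h2 : q ^ 2 ≤ s ^ 2 * gramEnergy M := by
    have e3 : gramEnergy M = ∑ p : Fin N × Fin N, (∑ i, M i p.1 * M i p.2) ^ 2 := by
      rw [gramEnergy, Fintype.sum_prod_type]
    have e4 : ∑ p : Fin N × Fin N, (y p.1 * y p.2) ^ 2 = (∑ j, y j ^ 2) ^ 2 := by
      rw [Fintype.sum_prod_type, sq (∑ j, y j ^ 2), Finset.sum_mul_sum]
      simp_rw [mul_pow]
    rw [e2, e3]
    refine (Finset.sum_mul_sq_le_sq_mul_sq _ _ _).trans ?_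
    rw [e4]
    refine mul_le_mul_of_nonneg_right ?_ (by positivity)
    exact pow_le_pow_left₀ (by positivity) (hsq hy) 2
  calc (∑ i, ∑ j, x i * y j * M i j) ^ 4 = ((∑ i, ∑ j, x i * y j * M i j) ^ 2) ^ 2 := by ring
    _ ≤ (s * q) ^ 2 := pow_le_pow_left₀ (sq_nonneg _) h1 2
    _ = s ^ 2 * q ^ 2 := by ring
    _ ≤ s ^ 2 * (s ^ 2 * gramEnergy M) := by gcongr
    _ = _ := by ring

/-! ### The truncated loss: comparison and decomposition -/

/-- The Gromov-Wasserstein loss with truncated cross entropies. -/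
noncomputable def truncLoss {N K : ℕ} (ε : ℝ) (A : Matrix (Fin N) (Fin N) Bool)
    (T : Matrix (Fin N) (Fin K) ℝ) (Θ : Matrix (Fin K) (Fin K) ℝ) : ℝ :=
  ∑ i, ∑ j, ∑ k, ∑ l,
    (if i = j then 0 else truncCrossEntropy ε (edgeIndicator (A i j)) (Θ k l)) * (T i k * T j l)

/-- The transport plan of a hard clustering. -/
noncomputable def clusterPlan {N K : ℕ} (z : Fin N → Fin K) : Matrix (Fin N) (Fin K) ℝ :=
  fun i k => if z i = k then 1 / (N : ℝ) else 0

/-- The centred adjacency matrix of a block model with labels `z`. -/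
def edgeNoise {N K : ℕ} (Θ : Matrix (Fin K) (Fin K) ℝ) (z : Fin N → Fin K)
    (A : Matrix (Fin N) (Fin N) Bool) : Matrix (Fin N) (Fin N) ℝ :=
  fun i j => if i = j then 0 else edgeIndicator (A i j) - Θ (z i) (z j)

theorem clusterPlan_mem {N K : ℕ} (z : Fin N → Fin K) :
    clusterPlan z ∈ transportPlans N K := by
  refine ⟨fun i k => ?_, fun i => by simp [clusterPlan]⟩
  unfold clusterPlan; split_ifs <;> positivity

section Loss

variable {N K : ℕ} {ε : ℝ} {A : Matrix (Fin N) (Fin N) Bool} {T : Matrix (Fin N) (Fin K) ℝ}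
  {Θ : Matrix (Fin K) (Fin K) ℝ}

theorem truncLoss_term_nonneg (hε : 0 < ε) (hε1 : ε ≤ 1) (hT : ∀ i k, 0 ≤ T i k)
    (hΘ : ∀ k l, Θ k l ∈ Set.Icc (0 : ℝ) 1) (i j : Fin N) (k l : Fin K) :
    0 ≤ (if i = j then 0 else truncCrossEntropy ε (edgeIndicator (A i j)) (Θ k l)) *
      (T i k * T j l) := by
  refine mul_nonneg ?_ (mul_nonneg (hT _ _) (hT _ _))
  split_ifs
  · exact le_rfl
  · exact (truncCrossEntropy_mem hε hε1 (edgeIndicator_mem _) (hΘ k l)).1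

theorem ofReal_truncLoss (hε : 0 < ε) (hε1 : ε ≤ 1) (hT : ∀ i k, 0 ≤ T i k)
    (hΘ : ∀ k l, Θ k l ∈ Set.Icc (0 : ℝ) 1) :
    ENNReal.ofReal (truncLoss ε A T Θ) = ∑ i, ∑ j, ∑ k, ∑ l,
      ENNReal.ofReal (if i = j then 0 else truncCrossEntropy ε (edgeIndicator (A i j)) (Θ k l)) *
        ENNReal.ofReal (T i k * T j l) := by
  have h := truncLoss_term_nonneg (A := A) hε hε1 hT hΘ
  have h3 : ∀ i j k, 0 ≤ ∑ l, (if i = j then 0 else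
      truncCrossEntropy ε (edgeIndicator (A i j)) (Θ k l)) * (T i k * T j l) :=
    fun i j k => Finset.sum_nonneg fun l _ => h i j k l
  have h2 := fun i j => Finset.sum_nonneg fun (k : Fin K) (_ : k ∈ Finset.univ) => h3 i j k
  have h1 := fun i => Finset.sum_nonneg fun (j : Fin N) (_ : j ∈ Finset.univ) => h2 i j
  rw [truncLoss, ENNReal.ofReal_sum_of_nonneg fun i _ => h1 i]
  refine Finset.sum_congr rfl fun i _ => ?_
  rw [ENNReal.ofReal_sum_of_nonneg fun j _ => h2 i j]
  refine Finset.sum_congr rfl fun j _ => ?_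
  rw [ENNReal.ofReal_sum_of_nonneg fun k _ => h3 i j k]
  refine Finset.sum_congr rfl fun k _ => ?_
  rw [ENNReal.ofReal_sum_of_nonneg fun l _ => h i j k l]
  exact Finset.sum_congr rfl fun l _ =>
    ENNReal.ofReal_mul' (mul_nonneg (hT _ _) (hT _ _))

theorem ofReal_truncLoss_le_gwLoss (hε : 0 < ε) (hε1 : ε ≤ 1) (hT : ∀ i k, 0 ≤ T i k)
    (hΘ : ∀ k l, Θ k l ∈ Set.Icc (0 : ℝ) 1) :
    ENNReal.ofReal (truncLoss ε A T Θ) ≤ gwLoss A T Θ := by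
  rw [ofReal_truncLoss hε hε1 hT hΘ]
  unfold gwLoss
  gcongr with i _ j _ k _ l _
  split_ifs
  · simp
  · exact truncCrossEntropy_le_negLogLik _ _ _

theorem gwLoss_eq_ofReal_truncLoss (hε : 0 < ε) (hε1 : ε ≤ 1) (hT : ∀ i k, 0 ≤ T i k)
    (hΘ : ∀ k l, Θ k l ∈ Set.Icc ε (1 - ε)) :
    gwLoss A T Θ = ENNReal.ofReal (truncLoss ε A T Θ) := by
  rw [ofReal_truncLoss hε hε1 hT
    fun k l => ⟨hε.le.trans (hΘ k l).1, (hΘ k l).2.trans (by linarith)⟩]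
  unfold gwLoss
  refine Finset.sum_congr rfl fun i _ => Finset.sum_congr rfl fun j _ =>
    Finset.sum_congr rfl fun k _ => Finset.sum_congr rfl fun l _ => ?_
  split_ifs
  · simp
  · rw [negLogLik_eq_truncCrossEntropy hε (hΘ k l)]

/-- Truncation lowers the loss of the estimator and does not alter that of an interior competitor,
so minimality survives in this direction. -/
theorem truncLoss_le_of_isSrGWEstimator {S : Set (Matrix (Fin K) (Fin K) ℝ)}
    {T' : Matrix (Fin N) (Fin K) ℝ} {Θ' : Matrix (Fin K) (Fin K) ℝ}
    (hS : ∀ Θ ∈ S, ∀ k l, Θ k l ∈ Set.Icc (0 : ℝ) 1) (h : IsSrGWEstimator S A T Θ)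
    (hε : 0 < ε) (hε1 : ε ≤ 1) (hT' : T' ∈ transportPlans N K) (hΘ'S : Θ' ∈ S)
    (hΘ' : ∀ k l, Θ' k l ∈ Set.Icc ε (1 - ε)) :
    truncLoss ε A T Θ ≤ truncLoss ε A T' Θ' := by
  have h1 := (ofReal_truncLoss_le_gwLoss (A := A) hε hε1 h.1.1 (hS _ h.2.1)).trans
    (h.2.2 T' hT' Θ' hΘ'S)
  rw [gwLoss_eq_ofReal_truncLoss hε hε1 hT'.1 hΘ', ENNReal.ofReal_le_ofReal_iff] at h1
  · exact h1
  · exact Finset.sum_nonneg fun i _ => Finset.sum_nonneg fun j _ => Finset.sum_nonneg fun k _ =>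
      Finset.sum_nonneg fun l _ => truncLoss_term_nonneg hε hε1 hT'.1 (hS _ hΘ'S) i j k l

theorem sum_sum_comm (f : Fin N → Fin N → Fin K → Fin K → ℝ) :
    ∑ i, ∑ j, ∑ k, ∑ l, f i j k l = ∑ k, ∑ l, ∑ i, ∑ j, f i j k l := by
  have h := Finset.sum_comm (s := (Finset.univ : Finset (Fin N × Fin N)))
    (t := (Finset.univ : Finset (Fin K × Fin K)))
    (f := fun (p : Fin N × Fin N) (q : Fin K × Fin K) => f p.1 p.2 q.1 q.2)
  simpa only [Fintype.sum_prod_type] using h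

/-- The truncated loss is the sum of its mean given the labels and of bilinear forms in the
noise. -/
theorem truncLoss_eq (Θs : Matrix (Fin K) (Fin K) ℝ) (z : Fin N → Fin K) :
    truncLoss ε A T Θ =
      (∑ i, ∑ j, ∑ k, ∑ l,
        (if i = j then 0 else truncCrossEntropy ε (Θs (z i) (z j)) (Θ k l)) * (T i k * T j l)) +
      ∑ k, ∑ l, (Real.log (max (1 - Θ k l) ε) - Real.log (max (Θ k l) ε)) *
        ∑ i, ∑ j, T i k * T j l * edgeNoise Θs z A i j := by
  simp_rw [Finset.mul_sum]
  rw [← sum_sum_comm (N := N) (K := K), truncLoss]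
  simp_rw [← Finset.sum_add_distrib]
  refine Finset.sum_congr rfl fun i _ => ?_
  refine Finset.sum_congr rfl fun j _ => ?_
  refine Finset.sum_congr rfl fun k _ => ?_
  refine Finset.sum_congr rfl fun l _ => ?_
  -- Cross entropy is affine in the mean, with slope the difference of the two logarithms; on the
  -- diagonal everything vanishes.
  unfold edgeNoise truncCrossEntropy
  split_ifs <;> ring

theorem transportPlans_le (hT : T ∈ transportPlans N K) (i : Fin N) (k : Fin K) :
    |T i k| ≤ 1 / (N : ℝ) := by
  rw [abs_of_nonneg (hT.1 i k), ← hT.2 i]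
  exact Finset.single_le_sum (fun k _ => hT.1 i k) (Finset.mem_univ k)

/-- Plan entries are at most `1 / N`, which cancels the scale `N ^ 4` of the Gram energy; truncation
bounds the slopes by `-log ε`. -/
theorem abs_noise_le (hN : 0 < N) (hT : T ∈ transportPlans N K) (hε : 0 < ε) (hε1 : ε ≤ 1)
    (hΘ : ∀ k l, Θ k l ∈ Set.Icc (0 : ℝ) 1) {M : Matrix (Fin N) (Fin N) ℝ} {D : ℝ} (hD : 0 ≤ D)
    (hM : gramEnergy M ≤ (N * D) ^ 4) :
    |∑ k, ∑ l, (Real.log (max (1 - Θ k l) ε) - Real.log (max (Θ k l) ε)) *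
        ∑ i, ∑ j, T i k * T j l * M i j| ≤ K ^ 2 * (-Real.log ε * D) := by
  have hN' : (0 : ℝ) < N := by exact_mod_cast hN
  have hB : ∀ k l, |∑ i, ∑ j, T i k * T j l * M i j| ≤ D := fun k l => by
    rw [← pow_le_pow_iff_left₀ (abs_nonneg _) hD (n := 4) (by norm_num), Even.pow_abs (by decide)]
    refine (bilin_pow_four_le M (fun i => transportPlans_le hT i k)
      (fun i => transportPlans_le hT i l)).trans ?_
    calc ((N : ℝ) * (1 / N) ^ 2) ^ 4 * gramEnergy M
        ≤ ((N : ℝ) * (1 / N) ^ 2) ^ 4 * (N * D) ^ 4 := by gcongr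
      _ = D ^ 4 := by field_simp
  have hs : ∀ k l, |Real.log (max (1 - Θ k l) ε) - Real.log (max (Θ k l) ε)| ≤ -Real.log ε :=
    fun k l => by
      obtain ⟨h1, h2⟩ := neg_log_max_mem hε hε1 (hΘ k l).2
      obtain ⟨h3, h4⟩ := neg_log_max_mem (x := 1 - Θ k l) hε hε1 (by linarith [(hΘ k l).1])
      rw [abs_le]; constructor <;> linarith
  calc _ ≤ ∑ k : Fin K, ∑ l : Fin K, -Real.log ε * D := by
        refine (Finset.abs_sum_le_sum_abs _ _).trans (Finset.sum_le_sum fun k _ => ?_)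
        refine (Finset.abs_sum_le_sum_abs _ _).trans (Finset.sum_le_sum fun l _ => ?_)
        rw [abs_mul]
        exact mul_le_mul (hs k l) (hB k l) (abs_nonneg _) ((abs_nonneg _).trans (hs k l))
    _ = _ := by simp; ring

theorem sum_mul_plan (hT : T ∈ transportPlans N K) (i j : Fin N) (c : ℝ) :
    ∑ k, ∑ l, c * (T i k * T j l) = c * (1 / N) ^ 2 := by
  simp_rw [← Finset.mul_sum]
  rw [← Finset.sum_mul, hT.2, hT.2]
  ring

/-- Under a minimizer, the squared distance to the true parameters averages to little. -/
theorem weighted_sq_dist_le (hN : 0 < N) (hT : T ∈ transportPlans N K) (hε : 0 < ε)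
    (hε1 : ε ≤ 1) (hΘ : ∀ k l, Θ k l ∈ Set.Icc (0 : ℝ) 1) {Θs : Matrix (Fin K) (Fin K) ℝ}
    (hΘs : ∀ k l, Θs k l ∈ Set.Icc ε (1 - ε)) {z : Fin N → Fin K} {D : ℝ} (hD : 0 ≤ D)
    (hM : gramEnergy (edgeNoise Θs z A) ≤ (N * D) ^ 4)
    (hmin : truncLoss ε A T Θ ≤ truncLoss ε A (clusterPlan z) Θs) :
    ∑ i, ∑ j, ∑ k, ∑ l, (Θs (z i) (z j) - max (Θ k l) ε) ^ 2 * (T i k * T j l) ≤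
      4 * (ε + -Real.log ε / N + 2 * (K ^ 2 * (-Real.log ε * D))) := by
  have hN' : (0 : ℝ) < N := by exact_mod_cast hN
  have hΘs' : ∀ k l, Θs k l ∈ Set.Icc (0 : ℝ) 1 :=
    fun k l => ⟨hε.le.trans (hΘs k l).1, (hΘs k l).2.trans (by linarith)⟩
  have hw : ∀ i j k l, 0 ≤ T i k * T j l := fun i j k l => mul_nonneg (hT.1 _ _) (hT.1 _ _)
  have hL : 0 ≤ -Real.log ε := by
    have := Real.log_nonpos hε.le hε1
    linarith
  rw [truncLoss_eq Θs z, truncLoss_eq (T := clusterPlan z) Θs z] at hmin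
  have b1 := abs_le.1 (abs_noise_le hN hT hε hε1 hΘ hD hM)
  have b2 := abs_le.1 (abs_noise_le hN (clusterPlan_mem z) hε hε1 hΘs' hD hM)
  -- the mean loss of the true parameters
  have u : (∑ i, ∑ j, ∑ k, ∑ l,
      (if i = j then 0 else truncCrossEntropy ε (Θs (z i) (z j)) (Θs k l)) *
        (clusterPlan z i k * clusterPlan z j l)) ≤
      ∑ i, ∑ j, truncCrossEntropy ε (Θs (z i) (z j)) (Θs (z i) (z j)) * (1 / (N : ℝ)) ^ 2 := by
    refine Finset.sum_le_sum fun i _ => Finset.sum_le_sum fun j _ => ?_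
    have h0 := (truncCrossEntropy_mem hε hε1 (hΘs' (z i) (z j)) (hΘs' (z i) (z j))).1
    rw [Finset.sum_eq_single (z i), Finset.sum_eq_single (z j)]
    · simp only [clusterPlan, if_true]
      split_ifs
      · rw [zero_mul]; positivity
      · rw [sq]
    · intro l _ hl; simp [clusterPlan, hl.symm]
    · simp
    · intro k _ hk; simp [clusterPlan, hk.symm]
    · simp
  -- the mean loss of the estimator
  have v : (∑ i, ∑ j, ∑ k, ∑ l,
      truncCrossEntropy ε (Θs (z i) (z j)) (Θ k l) * (T i k * T j l)) ≤
      (∑ i, ∑ j, ∑ k, ∑ l,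
        (if i = j then 0 else truncCrossEntropy ε (Θs (z i) (z j)) (Θ k l)) *
          (T i k * T j l)) + -Real.log ε / N := by
    -- The price of restoring the `N` diagonal pairs, each of mass `1 / N ^ 2`.
    have e : -Real.log ε / N = ∑ i : Fin N, ∑ j : Fin N, ∑ k, ∑ l,
        (if i = j then -Real.log ε else 0) * (T i k * T j l) := by
      simp_rw [sum_mul_plan hT, ite_mul, zero_mul, Finset.sum_ite_eq]
      simp
      field_simp
    rw [e]
    simp_rw [← Finset.sum_add_distrib, ← add_mul]
    gcongr with i _ j _ k _ l _
    · exact hw i j k l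
    have h0 := (truncCrossEntropy_mem hε hε1 (hΘs' (z i) (z j)) (hΘ k l)).2
    split_ifs <;> simp [h0]
  have g : (∑ i, ∑ j, ∑ k, ∑ l,
      ((Θs (z i) (z j) - max (Θ k l) ε) ^ 2 / 4 - ε) * (T i k * T j l)) ≤
      ∑ i, ∑ j, ∑ k, ∑ l, (truncCrossEntropy ε (Θs (z i) (z j)) (Θ k l) -
        truncCrossEntropy ε (Θs (z i) (z j)) (Θs (z i) (z j))) * (T i k * T j l) := by
    exact Finset.sum_le_sum fun i _ => Finset.sum_le_sum fun j _ => Finset.sum_le_sum fun k _ =>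
      Finset.sum_le_sum fun l _ => mul_le_mul_of_nonneg_right
        (truncCrossEntropy_gap hε (hΘs _ _) (hΘ _ _)) (hw i j k l)
  -- The subtracted entropy does not depend on `k, l`, so the row sums of the plan reduce it to the
  -- bound `u` for the true parameters.
  simp_rw [sub_mul, Finset.sum_sub_distrib, sum_mul_plan hT] at g
  have e1 : ∑ _i : Fin N, ∑ _j : Fin N, ε * (1 / (N : ℝ)) ^ 2 = ε := by
    simp; field_simp
  have e2 : ∑ i, ∑ j, ∑ k, ∑ l, (Θs (z i) (z j) - max (Θ k l) ε) ^ 2 / 4 * (T i k * T j l) =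
      (∑ i, ∑ j, ∑ k, ∑ l, (Θs (z i) (z j) - max (Θ k l) ε) ^ 2 * (T i k * T j l)) / 4 := by
    simp_rw [Finset.sum_div]
    refine Finset.sum_congr rfl fun i _ => Finset.sum_congr rfl fun j _ =>
      Finset.sum_congr rfl fun k _ => Finset.sum_congr rfl fun l _ => by ring
  rw [e1, e2] at g
  linarith [b1.1, b2.2]

end Loss

/-! ### Existence of minimizers -/

theorem continuous_negLogLik (a : Bool) : Continuous (negLogLik a) := by
  have h : negLogLik a =
      fun θ => (-ENNReal.log (ENNReal.ofReal (bernoulliMass a θ))).toENNReal := by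
    ext θ
    rw [ENNReal.log_ofReal, negLogLik]
    split_ifs
    · simp
    · rw [← EReal.coe_neg, EReal.toENNReal_of_ne_top (EReal.coe_ne_top _), EReal.toReal_coe]
  have hb : Continuous (bernoulliMass a) := by
    unfold bernoulliMass
    cases a <;> simp <;> fun_prop
  rw [h]
  exact EReal.continuous_toENNReal.comp
    (continuous_neg.comp (ENNReal.continuous_log.comp (ENNReal.continuous_ofReal.comp hb)))

/-- Multiplication on `[0, ∞]` is discontinuous at `(0, ∞)`, but `0 * ∞ = 0` is the least possible
value there. -/
theorem lowerSemicontinuous_ennreal_mul {X : Type*} [TopologicalSpace X] {f g : X → ℝ≥0∞}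
    (hf : Continuous f) (hg : Continuous g) : LowerSemicontinuous fun x => f x * g x := by
  rw [lowerSemicontinuous_iff_le_liminf]
  intro x
  have h := ENNReal.le_liminf_mul (f := 𝓝 x) (u := f) (v := g)
  rwa [(hf.tendsto x).liminf_eq, (hg.tendsto x).liminf_eq] at h

theorem lowerSemicontinuous_gwLoss {N K : ℕ} (A : Matrix (Fin N) (Fin N) Bool) :
    LowerSemicontinuous fun p : Matrix (Fin N) (Fin K) ℝ × Matrix (Fin K) (Fin K) ℝ =>
      gwLoss A p.1 p.2 := by
  unfold gwLoss
  refine lowerSemicontinuous_sum fun i _ => lowerSemicontinuous_sum fun j _ =>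
    lowerSemicontinuous_sum fun k _ => lowerSemicontinuous_sum fun l _ =>
      lowerSemicontinuous_ennreal_mul ?_ ?_
  · split_ifs
    · exact continuous_const
    · exact (continuous_negLogLik _).comp
        ((continuous_apply_apply (ρ := fun _ _ => ℝ) k l).comp continuous_snd)
  · refine ENNReal.continuous_ofReal.comp (Continuous.mul ?_ ?_)
    · exact (continuous_apply_apply (ρ := fun _ _ => ℝ) i k).comp continuous_fst
    · exact (continuous_apply_apply (ρ := fun _ _ => ℝ) j l).comp continuous_fst

theorem isCompact_of_entries_mem_Icc {m n : Type*} {S : Set (Matrix m n ℝ)} (hS : IsClosed S)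
    {a b : ℝ} (h : ∀ M ∈ S, ∀ i j, M i j ∈ Set.Icc a b) : IsCompact S := by
  have hc : IsCompact (Set.univ.pi fun _ : m => Set.univ.pi fun _ : n => Set.Icc a b) :=
    isCompact_univ_pi fun _ => isCompact_univ_pi fun _ => isCompact_Icc
  exact hc.of_isClosed_subset hS fun M hM i _ j _ => h M hM i j

theorem isCompact_transportPlans (N K : ℕ) : IsCompact (transportPlans N K) := by
  refine isCompact_of_entries_mem_Icc (a := 0) (b := 1 / (N : ℝ)) ?_ fun T hT i k =>
    ⟨hT.1 i k, (le_abs_self _).trans (transportPlans_le hT i k)⟩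
  have hcont : ∀ i k, Continuous fun T : Matrix (Fin N) (Fin K) ℝ => T i k :=
    fun i k => continuous_apply_apply (ρ := fun _ _ => ℝ) i k
  refine IsClosed.inter (s₁ := {T : Matrix (Fin N) (Fin K) ℝ | ∀ i k, 0 ≤ T i k})
    (s₂ := {T : Matrix (Fin N) (Fin K) ℝ | ∀ i, ∑ k, T i k = 1 / (N : ℝ)}) ?_ ?_
  · simp only [Set.ofPred_forall]
    exact isClosed_iInter fun i => isClosed_iInter fun k =>
      isClosed_le continuous_const (hcont i k)
  · simp only [Set.ofPred_forall]
    exact isClosed_iInter fun i =>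
      isClosed_eq (continuous_finsetSum _ fun k _ => hcont i k) continuous_const

theorem exists_isSrGWEstimator {N K : ℕ} [Nonempty (Fin K)] {S : Set (Matrix (Fin K) (Fin K) ℝ)}
    (hSclosed : IsClosed S) (hS : ∀ Θ ∈ S, ∀ k l, Θ k l ∈ Set.Icc (0 : ℝ) 1) (hne : S.Nonempty)
    (A : Matrix (Fin N) (Fin N) Bool) : ∃ T Θ, IsSrGWEstimator S A T Θ := by
  obtain ⟨Θ₀, hΘ₀⟩ := hne
  have hcompact : IsCompact (transportPlans N K ×ˢ S) :=
    (isCompact_transportPlans N K).prod (isCompact_of_entries_mem_Icc hSclosed hS)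
  have hnonempty : (transportPlans N K ×ˢ S).Nonempty :=
    ⟨(clusterPlan fun _ => Classical.arbitrary _, Θ₀),
      Set.mk_mem_prod (clusterPlan_mem _) hΘ₀⟩
  obtain ⟨p, hmem, hmin⟩ := LowerSemicontinuousOn.exists_isMinOn hnonempty hcompact
    ((lowerSemicontinuous_gwLoss A).lowerSemicontinuousOn _)
  rw [isMinOn_iff] at hmin
  exact ⟨p.1, p.2, hmem.1, hmem.2, fun T' hT' Θ' hΘ' => hmin (T', Θ') (Set.mk_mem_prod hT' hΘ')⟩

/-! ### From small average error to a permutation -/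

/-- A transport plan sends a substantial part of every large cluster to a single column; along
these columns the parameters are close to the true ones. -/
theorem exists_columns_close {N K : ℕ} {T : Matrix (Fin N) (Fin K) ℝ}
    (hT : T ∈ transportPlans N K) {Θs m : Matrix (Fin K) (Fin K) ℝ} {z : Fin N → Fin K}
    {c B : ℝ} (hc : 0 ≤ c) (hcount : ∀ q, c ≤ ∑ i, if z i = q then 1 / (N : ℝ) else 0)
    (hB : ∑ i, ∑ j, ∑ k, ∑ l, (Θs (z i) (z j) - m k l) ^ 2 * (T i k * T j l) ≤ B) :
    ∃ τ : Fin K → Fin K, ∀ q r, (c / K) ^ 2 * (Θs q r - m (τ q) (τ r)) ^ 2 ≤ B := by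
  -- Pigeonhole: the mass of cluster `q`, at least `c`, is shared among `K` columns.
  have hcol : ∀ q, ∃ k, c / K ≤ ∑ i, if z i = q then T i k else 0 := fun q => by
    have : Nonempty (Fin K) := ⟨q⟩
    have hK : (K : ℝ) ≠ 0 := by exact_mod_cast (Fin.pos q).ne'
    have h : ∑ _k : Fin K, c / K ≤ ∑ k, ∑ i, if z i = q then T i k else 0 := by
      rw [Finset.sum_comm]
      refine le_trans (le_of_eq ?_) ((hcount q).trans (le_of_eq ?_))
      · simp; field_simp
      · refine Finset.sum_congr rfl fun i _ => ?_
        split_ifs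
        · exact (hT.2 i).symm
        · simp
    obtain ⟨k, -, hk⟩ := Finset.exists_le_of_sum_le Finset.univ_nonempty h
    exact ⟨k, hk⟩
  choose τ hτ using hcol
  refine ⟨τ, fun q r => le_trans ?_ hB⟩
  have hcK : 0 ≤ c / K := by positivity
  have hnn : ∀ i j k l, 0 ≤ (Θs (z i) (z j) - m k l) ^ 2 * (T i k * T j l) := fun i j k l =>
    mul_nonneg (sq_nonneg _) (mul_nonneg (hT.1 _ _) (hT.1 _ _))
  calc (c / K) ^ 2 * (Θs q r - m (τ q) (τ r)) ^ 2
      ≤ ((∑ i, if z i = q then T i (τ q) else 0) * ∑ j, if z j = r then T j (τ r) else 0) *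
        (Θs q r - m (τ q) (τ r)) ^ 2 := by
        rw [sq (c / K)]
        exact mul_le_mul_of_nonneg_right
          (mul_le_mul (hτ q) (hτ r) hcK (hcK.trans (hτ q))) (sq_nonneg _)
    _ = ∑ i, ∑ j, (if z i = q then T i (τ q) else 0) * (if z j = r then T j (τ r) else 0) *
        (Θs q r - m (τ q) (τ r)) ^ 2 := by
        rw [Finset.sum_mul_sum]; simp_rw [Finset.sum_mul]
    _ ≤ _ := by
        refine Finset.sum_le_sum fun i _ => Finset.sum_le_sum fun j _ => ?_
        refine le_trans ?_ (Finset.single_le_sum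
          (fun k _ => Finset.sum_nonneg fun l _ => hnn i j k l) (Finset.mem_univ (τ q)))
        refine le_trans ?_ (Finset.single_le_sum
          (fun l _ => hnn i j (τ q) l) (Finset.mem_univ (τ r)))
        split_ifs with h1 h2
        · rw [h1, h2]; exact le_of_eq (mul_comm _ _)
        all_goals simpa using hnn i j (τ q) (τ r)

/-- A relabelling that nearly preserves the connectivity of distinct clusters is injective. -/
theorem DistinctClusters.exists_injective_of_close {K : ℕ} {Θs : Matrix (Fin K) (Fin K) ℝ}
    (h : DistinctClusters Θs) : ∃ s > 0, ∀ (Θ : Matrix (Fin K) (Fin K) ℝ) (τ : Fin K → Fin K),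
      (∀ q r, |Θ (τ q) (τ r) - Θs q r| < s) → Function.Injective τ := by
  -- Take `s` below half of every nonzero gap between entries of `Θs`; two distinct entries then
  -- cannot both be within `s` of the same number.
  have hev : ∀ᶠ s : ℝ in 𝓝[>] 0, ∀ q r q' r', Θs q r ≠ Θs q' r' →
      2 * s < |Θs q r - Θs q' r'| := by
    simp only [eventually_all]
    intro q r q' r' hne
    have hlt : Tendsto (fun s : ℝ => 2 * s) (𝓝[>] 0) (𝓝 (2 * 0)) :=
      (Continuous.tendsto (by fun_prop) 0).mono_left nhdsWithin_le_nhds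
    exact hlt.eventually (gt_mem_nhds (by simpa [sub_eq_zero] using hne))
  obtain ⟨s, hs, hs0⟩ := (hev.and self_mem_nhdsWithin).exists
  refine ⟨s, hs0, fun Θ τ hclose q q' hqq' => ?_⟩
  by_contra hne
  obtain ⟨l, hl | hl⟩ := h q q' hne
  · have h1 := abs_lt.1 (hclose q l)
    have h2 := abs_lt.1 (hclose q' l)
    rw [hqq'] at h1
    have h3 := hs _ _ _ _ hl
    rw [lt_abs] at h3
    rcases h3 with h3 | h3 <;> linarith
  · have h1 := abs_lt.1 (hclose l q)
    have h2 := abs_lt.1 (hclose l q')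
    rw [hqq'] at h1
    have h3 := hs _ _ _ _ hl
    rw [lt_abs] at h3
    rcases h3 with h3 | h3 <;> linarith

/-- Deterministic consistency: if all clusters are large and the noise is small, an estimator is
close to the true parameters up to label switching. -/
theorem exists_perm_close {K : ℕ} {Θs : Matrix (Fin K) (Fin K) ℝ} (hA1 : DistinctClusters Θs)
    (hA2 : InteriorConnectivity Θs) {S : Set (Matrix (Fin K) (Fin K) ℝ)}
    (hS : ∀ Θ ∈ S, ∀ k l, Θ k l ∈ Set.Icc (0 : ℝ) 1) (hmem : Θs ∈ S) (hK : 0 < K)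
    {c η : ℝ} (hc : 0 < c) (hη : 0 < η) :
    ∃ δ > 0, ∃ N₀ : ℕ, ∀ N ≥ N₀, ∀ (A : Matrix (Fin N) (Fin N) Bool) (z : Fin N → Fin K)
      (T : Matrix (Fin N) (Fin K) ℝ) (Θ : Matrix (Fin K) (Fin K) ℝ), IsSrGWEstimator S A T Θ →
      (∀ q, c ≤ ∑ i, if z i = q then 1 / (N : ℝ) else 0) →
      gramEnergy (edgeNoise Θs z A) ≤ δ * N ^ 4 →
      ∃ σ : Equiv.Perm (Fin K), ∀ k l, |Θ (σ k) (σ l) - Θs k l| < η := by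
  obtain ⟨s, hs, hinj⟩ := hA1.exists_injective_of_close
  obtain ⟨ζ, hζ, hΘs⟩ := hA2
  have hK' : (0 : ℝ) < K := by exact_mod_cast hK
  set η' := min η s with hη'
  have hη'0 : 0 < η' := lt_min hη hs
  -- Error budget: `ε`, `L / N` and the noise each get `β / 3`, and `4 * β` divided by `(c / K) ^ 2`
  -- is `(η' / 2) ^ 2`. Since `L` depends on `ε`, the truncation is fixed before `D` and `N₀`; `ε ≤
  -- η' / 4` absorbs the passage from `max Θ ε` to `Θ`.
  set β := (c / K) ^ 2 * (η' / 2) ^ 2 / 4 with hβ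
  have hβ0 : 0 < β := by positivity
  set ε := min ζ (min (η' / 4) (β / 3)) with hε
  have hε0 : 0 < ε := lt_min hζ.1 (lt_min (by positivity) (by positivity))
  have hε1 : ε ≤ 1 := (min_le_left _ _).trans hζ.2.le
  have hεη : ε ≤ η' / 4 := (min_le_right _ _).trans (min_le_left _ _)
  have hεβ : ε ≤ β / 3 := (min_le_right _ _).trans (min_le_right _ _)
  have hΘsε : ∀ k l, Θs k l ∈ Set.Icc ε (1 - ε) := fun k l =>
    ⟨(min_le_left _ _).trans (hΘs k l).1, (hΘs k l).2.trans (sub_le_sub_left (min_le_left _ _) 1)⟩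
  set L := -Real.log ε with hL
  have hL0 : 0 ≤ L := by
    have := Real.log_nonpos hε0.le hε1
    linarith
  set D := β / (3 * (2 * K ^ 2 * L + 1)) with hD
  have hD0 : 0 < D := by positivity
  have hDβ : 2 * (K ^ 2 * (L * D)) ≤ β / 3 := by
    have : D * (3 * (2 * K ^ 2 * L + 1)) = β := div_mul_cancel₀ _ (by positivity)
    nlinarith
  obtain ⟨N₀, hN₀⟩ := exists_nat_ge (3 * L / β)
  refine ⟨D ^ 4, by positivity, N₀ + 1, fun N hN A z T Θ hest hcount hnoise => ?_⟩
  have hN0 : 0 < N := by omega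
  have hN' : (0 : ℝ) < N := by exact_mod_cast hN0
  have hLN : L / N ≤ β / 3 := by
    have h1 : (N₀ : ℝ) ≤ N := by exact_mod_cast (by omega : N₀ ≤ N)
    have h2 := hN₀.trans h1
    rw [div_le_iff₀ hβ0] at h2
    rw [div_le_iff₀ hN']
    linarith
  have hW := weighted_sq_dist_le hN0 hest.1 hε0 hε1 (hS Θ hest.2.1) hΘsε hD0.le
    (hnoise.trans (le_of_eq (by ring)))
    (truncLoss_le_of_isSrGWEstimator hS hest hε0 hε1 (clusterPlan_mem z) hmem hΘsε)
  obtain ⟨τ, hτ⟩ := exists_columns_close hest.1 hc.le hcount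
    (m := fun k l => max (Θ k l) ε) hW
  have hclose : ∀ q r, |Θ (τ q) (τ r) - Θs q r| < η' := fun q r => by
    have h1 : (c / K) ^ 2 * (Θs q r - max (Θ (τ q) (τ r)) ε) ^ 2 ≤
        (c / K) ^ 2 * (η' / 2) ^ 2 := (hτ q r).trans (by linarith)
    have h2 := abs_le_of_sq_le_sq (le_of_mul_le_mul_left h1 (by positivity)) (by positivity)
    rw [abs_le] at h2
    have h3 : max (Θ (τ q) (τ r)) ε ≤ Θ (τ q) (τ r) + ε :=
      max_le (by linarith) (by linarith [(hS Θ hest.2.1 (τ q) (τ r)).1])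
    have h4 := le_max_left (Θ (τ q) (τ r)) ε
    rw [abs_lt]
    constructor <;> linarith
  have hinjτ := hinj Θ τ fun q r => (hclose q r).trans_le (min_le_right _ _)
  exact ⟨Equiv.ofBijective τ hinjτ.bijective_of_finite, fun k l =>
    (hclose k l).trans_le (min_le_left _ _)⟩

/-! ### Second moments of the noise -/

/-- The unordered pair `{i, j}` as an increasing pair. -/
def orderedEdge {N : ℕ} {i j : Fin N} (h : i ≠ j) : {e : Fin N × Fin N // e.1 < e.2} :=
  ⟨(min i j, max i j), min_lt_max.2 h⟩

theorem orderedEdge_eq {N : ℕ} {i j k l : Fin N} {h : i ≠ j} {h' : k ≠ l}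
    (he : orderedEdge h = orderedEdge h') : (i = k ∧ j = l) ∨ (i = l ∧ j = k) := by
  have key : ∀ a b : Fin N, s(min a b, max a b) = s(a, b) := fun a b => by
    rcases le_total a b with h | h <;> simp [h, Sym2.eq_swap]
  have h1 : s(i, j) = s(k, l) := by
    rw [← key i j, ← key k l]
    have h2 := congrArg (fun e => s(e.1.1, e.1.2)) he
    exact h2
  simpa using h1

section Noise

variable {Ω : Type*} [MeasurableSpace Ω] {μ : Measure Ω} [IsProbabilityMeasure μ] {N K : ℕ}
  {Θ : Matrix (Fin K) (Fin K) ℝ} {z : Fin N → Fin K} {A : Ω → Matrix (Fin N) (Fin N) Bool}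

theorem measurable_edgeNoise (hmeas : ∀ i j, Measurable fun ω => A ω i j) (i j : Fin N) :
    Measurable fun ω => edgeNoise Θ z (A ω) i j := by
  unfold edgeNoise
  split_ifs
  · exact measurable_const
  · exact (measurable_of_finite (f := edgeIndicator)).comp (hmeas i j) |>.sub_const _

theorem abs_edgeNoise_le (hΘ : ∀ k l, Θ k l ∈ Set.Icc (0 : ℝ) 1)
    (B : Matrix (Fin N) (Fin N) Bool) (i j : Fin N) : |edgeNoise Θ z B i j| ≤ 1 := by
  unfold edgeNoise
  split_ifs
  · simp
  · obtain ⟨h1, h2⟩ := edgeIndicator_mem (B i j)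
    obtain ⟨h3, h4⟩ := hΘ (z i) (z j)
    rw [abs_le]; constructor <;> linarith

theorem integral_edgeNoise (hΘ : ∀ k l, Θ k l ∈ Set.Icc (0 : ℝ) 1)
    (hmeas : ∀ i j, Measurable fun ω => A ω i j)
    (hlaw : ∀ i j, i ≠ j → μ {ω | A ω i j = true} = ENNReal.ofReal (Θ (z i) (z j)))
    (i j : Fin N) : ∫ ω, edgeNoise Θ z (A ω) i j ∂μ = 0 := by
  unfold edgeNoise
  split_ifs with h
  · simp
  have hset : MeasurableSet {ω | A ω i j = true} := hmeas i j (measurableSet_singleton true)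
  have hind : (fun ω => edgeIndicator (A ω i j)) =
      Set.indicator {ω | A ω i j = true} (fun _ => (1 : ℝ)) := by
    ext ω; simp [edgeIndicator, Set.indicator]
  have hint : Integrable (fun ω => edgeIndicator (A ω i j)) μ := by
    rw [hind]; exact (integrable_const 1).indicator hset
  rw [integral_sub hint (integrable_const _), hind, integral_indicator_const _ hset]
  simp [measureReal_def, hlaw i j h, ENNReal.toReal_ofReal (hΘ (z i) (z j)).1]

/-- Unless a loop makes the product vanish, the edge `{i, j}` differs from the other three edges of
the four-cycle, so its centred factor is independent of their product. -/
theorem integral_edgeNoise_cycle (hΘ : ∀ k l, Θ k l ∈ Set.Icc (0 : ℝ) 1)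
    (hmeas : ∀ i j, Measurable fun ω => A ω i j) (hsymm : ∀ ω i j, A ω i j = A ω j i)
    (hind : iIndepFun (fun (e : {e : Fin N × Fin N // e.1 < e.2}) (ω : Ω) => A ω e.1.1 e.1.2) μ)
    (hlaw : ∀ i j, i ≠ j → μ {ω | A ω i j = true} = ENNReal.ofReal (Θ (z i) (z j)))
    {i i' j j' : Fin N} (hi : i ≠ i') (hj : j ≠ j') :
    ∫ ω, edgeNoise Θ z (A ω) i j * (edgeNoise Θ z (A ω) i j' *
      (edgeNoise Θ z (A ω) i' j * edgeNoise Θ z (A ω) i' j')) ∂μ = 0 := by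
  have hdiag : ∀ k ω, edgeNoise Θ z (A ω) k k = 0 := fun k ω => by simp [edgeNoise]
  by_cases h1 : i = j
  · subst h1; simp [hdiag]
  by_cases h2 : i = j'
  · subst h2; simp [hdiag]
  by_cases h3 : i' = j
  · subst h3; simp [hdiag]
  by_cases h4 : i' = j'
  · subst h4; simp [hdiag]
  have hA : ∀ {k l : Fin N} (h : k ≠ l) ω,
      A ω k l = A ω (orderedEdge h).1.1 (orderedEdge h).1.2 := fun {k l} h ω => by
    rcases le_total k l with hkl | hkl
    · simp [orderedEdge, hkl]
    · simp only [orderedEdge, min_eq_right hkl, max_eq_left hkl]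
      exact hsymm ω k l
  have hM : ∀ {k l : Fin N} (h : k ≠ l) ω, edgeNoise Θ z (A ω) k l =
      edgeIndicator (A ω (orderedEdge h).1.1 (orderedEdge h).1.2) - Θ (z k) (z l) :=
    fun h ω => by rw [← hA h ω, edgeNoise, if_neg h]
  classical
  set t : Finset {e : Fin N × Fin N // e.1 < e.2} :=
    {orderedEdge h2, orderedEdge h3, orderedEdge h4} with ht
  have hdisj : Disjoint {orderedEdge h1} t := by
    rw [Finset.disjoint_singleton_left, ht]
    simp only [Finset.mem_insert, Finset.mem_singleton, not_or]
    refine ⟨fun h => ?_, fun h => ?_, fun h => ?_⟩ <;> rcases orderedEdge_eq h with h | h <;>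
      simp_all
  have hpair := hind.indepFun_finset _ t hdisj fun e => hmeas _ _
  have hprod := hpair.comp
    (φ := fun v : ({orderedEdge h1} : Finset {e : Fin N × Fin N // e.1 < e.2}) → Bool =>
      edgeIndicator (v ⟨orderedEdge h1, by simp⟩) - Θ (z i) (z j))
    (ψ := fun v : t → Bool =>
      (edgeIndicator (v ⟨orderedEdge h2, by simp [ht]⟩) - Θ (z i) (z j')) *
      ((edgeIndicator (v ⟨orderedEdge h3, by simp [ht]⟩) - Θ (z i') (z j)) *
      (edgeIndicator (v ⟨orderedEdge h4, by simp [ht]⟩) - Θ (z i') (z j'))))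
    (measurable_of_finite _) (measurable_of_finite _)
  have hfact := hprod.integral_mul_eq_mul_integral
    ((measurable_of_finite _).comp (measurable_pi_lambda _ fun e => hmeas _ _)).aestronglyMeasurable
    ((measurable_of_finite _).comp (measurable_pi_lambda _ fun e => hmeas _ _)).aestronglyMeasurable
  have hzero := integral_edgeNoise (μ := μ) hΘ hmeas hlaw i j
  simp_rw [hM h1] at hzero
  simp_rw [hM h1, hM h2, hM h3, hM h4]
  exact hfact.trans (mul_eq_zero_of_left hzero _)

theorem abs_mul_le_one {a b : ℝ} (ha : |a| ≤ 1) (hb : |b| ≤ 1) : |a * b| ≤ 1 := by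
  rw [abs_mul]; exact mul_le_one₀ ha (abs_nonneg _) hb

/-- Of the `N ^ 4` four-cycles in the expansion only those with `i = i'` or `j = j'` can contribute,
each at most `1`. -/
theorem integral_gramEnergy_le (hΘ : ∀ k l, Θ k l ∈ Set.Icc (0 : ℝ) 1)
    (hmeas : ∀ i j, Measurable fun ω => A ω i j) (hsymm : ∀ ω i j, A ω i j = A ω j i)
    (hind : iIndepFun (fun (e : {e : Fin N × Fin N // e.1 < e.2}) (ω : Ω) => A ω e.1.1 e.1.2) μ)
    (hlaw : ∀ i j, i ≠ j → μ {ω | A ω i j = true} = ENNReal.ofReal (Θ (z i) (z j))) :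
    Integrable (fun ω => gramEnergy (edgeNoise Θ z (A ω))) μ ∧
      ∫ ω, gramEnergy (edgeNoise Θ z (A ω)) ∂μ ≤ 2 * N ^ 3 := by
  set M : Fin N → Fin N → Ω → ℝ := fun i j ω => edgeNoise Θ z (A ω) i j with hMdef
  have hMm : ∀ i j, Measurable (M i j) := fun i j => measurable_edgeNoise hmeas i j
  have hMb : ∀ i j ω, |M i j ω| ≤ 1 := fun i j ω => abs_edgeNoise_le hΘ (A ω) i j
  have hexp : ∀ ω, gramEnergy (edgeNoise Θ z (A ω)) = ∑ j, ∑ j', ∑ i, ∑ i',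
      M i j ω * (M i j' ω * (M i' j ω * M i' j' ω)) := fun ω => by
    unfold gramEnergy
    refine Finset.sum_congr rfl fun j _ => Finset.sum_congr rfl fun j' _ => ?_
    rw [sq, Finset.sum_mul_sum]
    exact Finset.sum_congr rfl fun i _ => Finset.sum_congr rfl fun i' _ => mul_assoc _ _ _
  have hb : ∀ i i' j j' ω, |M i j ω * (M i j' ω * (M i' j ω * M i' j' ω))| ≤ 1 :=
    fun i i' j j' ω => abs_mul_le_one (hMb _ _ _)
      (abs_mul_le_one (hMb _ _ _) (abs_mul_le_one (hMb _ _ _) (hMb _ _ _)))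
  have hint : ∀ i i' j j', Integrable
      (fun ω => M i j ω * (M i j' ω * (M i' j ω * M i' j' ω))) μ := fun i i' j j' =>
    Integrable.of_bound ((hMm _ _).mul ((hMm _ _).mul
      ((hMm _ _).mul (hMm _ _)))).aestronglyMeasurable 1 (ae_of_all _ fun ω => hb i i' j j' ω)
  have hle : ∀ i i' j j', ∫ ω, M i j ω * (M i j' ω * (M i' j ω * M i' j' ω)) ∂μ ≤
      (if j = j' then 1 else 0) + (if i = i' then 1 else 0) := fun i i' j j' => by
    have h1 : ∫ ω, M i j ω * (M i j' ω * (M i' j ω * M i' j' ω)) ∂μ ≤ 1 := by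
      refine (integral_mono (hint i i' j j') (integrable_const 1)
        fun ω => (le_abs_self _).trans (hb i i' j j' ω)).trans ?_
      simp
    by_cases hj : j = j'
    · rw [if_pos hj]; split_ifs <;> linarith
    by_cases hi : i = i'
    · rw [if_pos hi, if_neg hj]; linarith
    rw [if_neg hi, if_neg hj, hMdef, integral_edgeNoise_cycle hΘ hmeas hsymm hind hlaw hi hj]
    simp
  simp_rw [hexp]
  refine ⟨integrable_finsetSum _ fun j _ => integrable_finsetSum _ fun j' _ =>
    integrable_finsetSum _ fun i _ => integrable_finsetSum _ fun i' _ => hint i i' j j', ?_⟩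
  rw [integral_finsetSum _ fun j _ => integrable_finsetSum _ fun j' _ =>
    integrable_finsetSum _ fun i _ => integrable_finsetSum _ fun i' _ => hint i i' j j']
  calc _ ≤ ∑ j : Fin N, ∑ j' : Fin N, ∑ i : Fin N, ∑ i' : Fin N,
        (((if j = j' then 1 else 0) + (if i = i' then 1 else 0) : ℝ)) := by
        refine Finset.sum_le_sum fun j _ => ?_
        rw [integral_finsetSum _ fun j' _ =>
          integrable_finsetSum _ fun i _ => integrable_finsetSum _ fun i' _ => hint i i' j j']
        refine Finset.sum_le_sum fun j' _ => ?_
        rw [integral_finsetSum _ fun i _ => integrable_finsetSum _ fun i' _ => hint i i' j j']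
        refine Finset.sum_le_sum fun i _ => ?_
        rw [integral_finsetSum _ fun i' _ => hint i i' j j']
        exact Finset.sum_le_sum fun i' _ => hle i i' j j'
    _ = 2 * N ^ 3 := by
        simp [Finset.sum_add_distrib]
        ring

end Noise

/-! ### Probability of the bad events -/

/-- The noise of a block model is small with high probability. -/
theorem IsBernoulliSBM.measure_gramEnergy_le {Ω : Type*} [MeasurableSpace Ω] {P : Measure Ω}
    [IsProbabilityMeasure P] {N K : ℕ} {Θ : Matrix (Fin K) (Fin K) ℝ} {α : Fin K → ℝ}
    {Z : Ω → Fin N → Fin K} {A : Ω → Matrix (Fin N) (Fin N) Bool} (h : IsBernoulliSBM P Θ α Z A)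
    (hΘ : ∀ k l, Θ k l ∈ Set.Icc (0 : ℝ) 1) {δ : ℝ} (hδ : 0 < δ) (hN : 0 < N) :
    P {ω | δ * N ^ 4 ≤ gramEnergy (edgeNoise Θ (Z ω) (A ω))} ≤
      ENNReal.ofReal (2 / (δ * N)) := by
  have hN' : (0 : ℝ) < N := by exact_mod_cast hN
  have hZ : Measurable Z := measurable_pi_lambda _ h.measurable_labels
  have hZset : ∀ z, MeasurableSet {ω | Z ω = z} := fun z => hZ (measurableSet_singleton z)
  set E := {ω | δ * N ^ 4 ≤ gramEnergy (edgeNoise Θ (Z ω) (A ω))} with hE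
  -- Conditionally on each labelling of positive probability, Markov gives `2 * N ^ 3 / (δ * N ^
  -- 4)`; this is uniform in `z`, so it can be summed.
  have hz : ∀ z, P ({ω | Z ω = z} ∩ E) ≤
      ENNReal.ofReal (2 / (δ * N)) * P {ω | Z ω = z} := fun z => by
    by_cases h0 : P {ω | Z ω = z} = 0
    · rw [measure_mono_null Set.inter_subset_left h0]; exact zero_le
    have : IsProbabilityMeasure (cond P {ω | Z ω = z}) := cond_isProbabilityMeasure h0
    obtain ⟨hint, hle⟩ := integral_gramEnergy_le (z := z) hΘ h.measurable_edges h.symm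
      (h.edges_indep z h0) (h.edges_law z h0)
    have hmarkov := mul_meas_ge_le_integral_of_nonneg
      (ae_of_all (cond P {ω | Z ω = z}) fun ω => gramEnergy_nonneg (edgeNoise Θ z (A ω)))
      hint (δ * N ^ 4)
    have hsub : {ω | Z ω = z} ∩ E ⊆ {ω | Z ω = z} ∩
        {ω | δ * N ^ 4 ≤ gramEnergy (edgeNoise Θ z (A ω))} := by
      rintro ω ⟨h1, h2⟩
      refine ⟨h1, ?_⟩
      have h1' : Z ω = z := h1
      rw [← h1']; exact h2
    refine (measure_mono hsub).trans ?_
    rw [← cond_mul_eq_inter (hZset z)]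
    gcongr
    have h2 : (cond P {ω | Z ω = z}).real
        {ω | δ * N ^ 4 ≤ gramEnergy (edgeNoise Θ z (A ω))} ≤ 2 / (δ * N) := by
      rw [le_div_iff₀ (by positivity)]
      have h3 := hmarkov.trans hle
      have h4 : (0 : ℝ) < N ^ 3 := by positivity
      refine le_of_mul_le_mul_left (le_trans (le_of_eq ?_) (h3.trans (le_of_eq ?_))) h4 <;> ring
    rw [← ENNReal.ofReal_toReal (measure_ne_top (cond P {ω | Z ω = z}) _)]
    exact ENNReal.ofReal_le_ofReal h2
  calc P E ≤ P (⋃ z, {ω | Z ω = z} ∩ E) :=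
        measure_mono fun ω hω => Set.mem_iUnion.2 ⟨Z ω, rfl, hω⟩
    _ ≤ ∑ z, P ({ω | Z ω = z} ∩ E) := measure_iUnion_fintype_le _ _
    _ ≤ ∑ z, ENNReal.ofReal (2 / (δ * N)) * P {ω | Z ω = z} := Finset.sum_le_sum fun z _ => hz z
    _ = ENNReal.ofReal (2 / (δ * N)) * ∑ z, P (Z ⁻¹' {z}) := by rw [Finset.mul_sum]; rfl
    _ = ENNReal.ofReal (2 / (δ * N)) := by
        rw [sum_measure_preimage_singleton _ fun z _ => hZset z]
        simp

/-- A cluster is small with small probability only. -/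
theorem IsBernoulliSBM.measure_count_le {Ω : Type*} [MeasurableSpace Ω] {P : Measure Ω}
    [IsProbabilityMeasure P] {N K : ℕ} {Θ : Matrix (Fin K) (Fin K) ℝ} {α : Fin K → ℝ}
    {Z : Ω → Fin N → Fin K} {A : Ω → Matrix (Fin N) (Fin N) Bool} (h : IsBernoulliSBM P Θ α Z A)
    {γ : ℝ} (hγ : 0 < γ) (hN : 0 < N) {q : Fin K} (hq : γ ≤ α q) :
    P {ω | (∑ i, if Z ω i = q then 1 / (N : ℝ) else 0) < γ / 2} ≤
      ENNReal.ofReal (4 / γ ^ 2 / N) := by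
  have hN' : (0 : ℝ) < N := by exact_mod_cast hN
  set φ : Fin K → ℝ := fun k => if k = q then 1 else 0 with hφ
  have hφm : Measurable φ := measurable_of_finite φ
  set X : Fin N → Ω → ℝ := fun i ω => φ (Z ω i) with hX
  have hXm : ∀ i, Measurable (X i) := fun i => hφm.comp (h.measurable_labels i)
  have hX01 : ∀ i ω, X i ω ∈ Set.Icc (0 : ℝ) 1 := fun i ω => by
    simp only [hX, hφ]; split_ifs <;> simp
  have hXL : ∀ i, MemLp (X i) 2 P := fun i =>
    MemLp.of_bound (hXm i).aestronglyMeasurable 1 (ae_of_all _ fun ω => by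
      rw [Real.norm_eq_abs, abs_of_nonneg (hX01 i ω).1]; exact (hX01 i ω).2)
  have hmean : ∀ i, P[X i] = α q := fun i => by
    have hset : MeasurableSet {ω | Z ω i = q} :=
      h.measurable_labels i (measurableSet_singleton q)
    have hind : X i = Set.indicator {ω | Z ω i = q} (fun _ => (1 : ℝ)) := by
      ext ω; simp [hX, hφ, Set.indicator]
    rw [hind, integral_indicator_const _ hset]
    simp [measureReal_def, h.labels_law i q, ENNReal.toReal_ofReal (hγ.le.trans hq)]
  have hvar : Var[∑ i, X i; P] ≤ N := by
    rw [IndepFun.variance_sum (fun i _ => hXL i)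
      fun i _ j _ hij => (h.labels_indep.indepFun hij).comp hφm hφm]
    calc ∑ i, Var[X i; P] ≤ ∑ _i : Fin N, (1 : ℝ) := Finset.sum_le_sum fun i _ =>
          (variance_le_sq_of_bounded (ae_of_all _ (hX01 i)) (hXm i).aemeasurable).trans
            (by norm_num)
      _ = N := by simp
  have hS : P[∑ i, X i] = N * α q := by
    have h1 : ∫ ω, (∑ i, X i) ω ∂P = ∑ i, ∫ ω, X i ω ∂P := by
      simp_rw [Finset.sum_apply]
      exact integral_finsetSum _ fun i _ => (hXL i).integrable one_le_two
    rw [h1, Finset.sum_congr rfl fun i _ => hmean i]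
    simp
  -- The mean count is at least `N * γ`, so a count below `N * γ / 2` deviates by at least `N * γ /
  -- 2`.
  have hcheb := meas_ge_le_variance_div_sq
    (memLp_finsetSum' (Finset.univ : Finset (Fin N)) fun i _ => hXL i)
    (c := N * (γ / 2)) (by positivity)
  rw [hS] at hcheb
  refine (measure_mono fun ω hω => ?_).trans (hcheb.trans (ENNReal.ofReal_le_ofReal ?_))
  · have hω' : (∑ i, if Z ω i = q then 1 / (N : ℝ) else 0) < γ / 2 := hω
    have hsum : (∑ i, if Z ω i = q then 1 / (N : ℝ) else 0) = (∑ i, X i) ω / N := by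
      rw [Finset.sum_apply, Finset.sum_div]
      refine Finset.sum_congr rfl fun i _ => ?_
      simp only [hX, hφ]; split_ifs <;> simp
    rw [hsum, div_lt_iff₀ hN'] at hω'
    have h2 := mul_le_mul_of_nonneg_left hq hN'.le
    change N * (γ / 2) ≤ |(∑ i, X i) ω - N * α q|
    rw [le_abs]; right; linarith
  · calc Var[∑ i, X i; P] / (N * (γ / 2)) ^ 2 ≤ N / (N * (γ / 2)) ^ 2 := by gcongr
      _ = 4 / γ ^ 2 / N := by field_simp; norm_num

/-! ### Convergence in probability -/

theorem tendsto_ofReal_const_div_nat (c : ℝ) :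
    Tendsto (fun N : ℕ => ENNReal.ofReal (c / N)) atTop (𝓝 0) := by
  simpa using ENNReal.tendsto_ofReal (tendsto_const_div_atTop_nhds_zero_nat c)

/-- A relabelling which brings `Θ` as close to `Θs` as possible. -/
noncomputable def bestRelabelling {K : ℕ} (Θs Θ : Matrix (Fin K) (Fin K) ℝ) :
    Equiv.Perm (Fin K) :=
  (Finite.exists_min fun σ : Equiv.Perm (Fin K) =>
    edist (fun k l => Θ (σ k) (σ l)) (fun k l => Θs k l)).choose

/-- `exists_perm_close` yields a permutation that may depend on the tolerance, while convergence in
measure needs one for all tolerances; the best relabelling does at least as well as each. -/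
theorem edist_bestRelabelling_lt {K : ℕ} {Θs Θ : Matrix (Fin K) (Fin K) ℝ} {η : ℝ≥0∞}
    (hη : 0 < η) (hη' : η ≠ ∞) {σ : Equiv.Perm (Fin K)}
    (h : ∀ k l, |Θ (σ k) (σ l) - Θs k l| < η.toReal) :
    edist (fun k l => Θ (bestRelabelling Θs Θ k) (bestRelabelling Θs Θ l))
      (fun k l => Θs k l) < η := by
  refine ((Finite.exists_min fun σ : Equiv.Perm (Fin K) =>
    edist (fun k l => Θ (σ k) (σ l)) (fun k l => Θs k l)).choose_spec σ).trans_lt ?_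
  have hpos := ENNReal.toReal_pos hη.ne' hη'
  rw [edist_dist, ENNReal.ofReal_lt_iff_lt_toReal dist_nonneg hη', dist_pi_lt_iff hpos]
  exact fun k => (dist_pi_lt_iff hpos).2 fun l => h k l

theorem theorem2 {K : ℕ} (Θstar : Matrix (Fin K) (Fin K) ℝ) (α : Fin K → ℝ)
    (hα : α ∈ stdSimplex ℝ (Fin K))
    (hA1 : DistinctClusters Θstar) (hA2 : InteriorConnectivity Θstar) (hA3 : NondegenerateProportions α)
    -- the parameter set of the estimator, for instance all of `[0, 1] ^ (K × K)`
    (S : Set (Matrix (Fin K) (Fin K) ℝ)) (hSclosed : IsClosed S)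
    (hS : ∀ Θ ∈ S, ∀ k l, Θ k l ∈ Set.Icc (0 : ℝ) 1) (hmem : Θstar ∈ S) :
    -- estimators exist
    (∀ (N : ℕ) (a : Matrix (Fin N) (Fin N) Bool), ∃ T Θ, IsSrGWEstimator S a T Θ) ∧
    -- and all of them are consistent, up to a relabelling of the clusters
    (∀ {Ω : Type*} [MeasurableSpace Ω] (P : Measure Ω) [IsProbabilityMeasure P]
      (Z : (N : ℕ) → Ω → Fin N → Fin K) (A : (N : ℕ) → Ω → Matrix (Fin N) (Fin N) Bool),
      (∀ N, IsBernoulliSBM P Θstar α (Z N) (A N)) →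
      ∀ (That : (N : ℕ) → Ω → Matrix (Fin N) (Fin K) ℝ) (Θhat : ℕ → Ω → Matrix (Fin K) (Fin K) ℝ),
      (∀ N ω, IsSrGWEstimator S (A N ω) (That N ω) (Θhat N ω)) →
      ∃ σ : ℕ → Ω → Equiv.Perm (Fin K),
        TendstoInMeasure P
          (fun (N : ℕ) (ω : Ω) (k l : Fin K) => Θhat N ω (σ N ω k) (σ N ω l))
          atTop (fun (_ : Ω) (k l : Fin K) => Θstar k l)) := by
  have hK : 0 < K := by
    rcases Nat.eq_zero_or_pos K with rfl | h
    · simpa using hα.2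
    · exact h
  have : Nonempty (Fin K) := ⟨⟨0, hK⟩⟩
  refine ⟨fun N a => exists_isSrGWEstimator hSclosed hS ⟨_, hmem⟩ a, ?_⟩
  intro Ω _ P _ Z A hSBM That Θhat hest
  obtain ⟨γ, hγ, hαγ⟩ := hA3
  refine ⟨fun N ω => bestRelabelling Θstar (Θhat N ω),
    tendstoInMeasure_of_ne_top fun η hη hη' => ?_⟩
  obtain ⟨δ, hδ, N₀, hclose⟩ := exists_perm_close hA1 hA2 hS hmem hK (half_pos hγ.1)
    (ENNReal.toReal_pos hη.ne' hη')
  have hlim : Tendsto (fun N : ℕ => ENNReal.ofReal (2 / δ / N) +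
      ∑ _q : Fin K, ENNReal.ofReal (4 / γ ^ 2 / N)) atTop (𝓝 0) := by
    have h := (tendsto_ofReal_const_div_nat (2 / δ)).add
      (tendsto_finsetSum Finset.univ fun (_ : Fin K) _ =>
        tendsto_ofReal_const_div_nat (4 / γ ^ 2))
    rwa [Finset.sum_const_zero, add_zero] at h
  refine tendsto_of_tendsto_of_tendsto_of_le_of_le' tendsto_const_nhds hlim
    (Eventually.of_forall fun _ => zero_le) ?_
  filter_upwards [eventually_ge_atTop (N₀ + 1)] with N hN
  have hN0 : 0 < N := by omega
  have hnoise := (hSBM N).measure_gramEnergy_le (hS _ hmem) hδ hN0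
  rw [← div_div] at hnoise
  have hcount : ∀ q, _ := fun q => (hSBM N).measure_count_le hγ.1 hN0 (hαγ q).1
  -- Only monotonicity and subadditivity of `P` are used, so the estimators need not be measurable.
  refine (measure_mono (t := {ω | δ * N ^ 4 ≤ gramEnergy (edgeNoise Θstar (Z N ω) (A N ω))} ∪
    ⋃ q, {ω | (∑ i, if Z N ω i = q then 1 / (N : ℝ) else 0) < γ / 2}) fun ω hω => ?_).trans
    ((measure_union_le _ _).trans (add_le_add hnoise ((measure_iUnion_fintype_le _ _).trans
      (Finset.sum_le_sum fun q _ => hcount q))))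
  by_contra hgood
  simp only [Set.mem_union, Set.mem_iUnion, Set.mem_ofPred_eq, not_or, not_exists, not_le,
    not_lt] at hgood
  obtain ⟨σ, hσ⟩ := hclose N (by omega) (A N ω) (Z N ω) (That N ω) (Θhat N ω) (hest N ω)
    hgood.2 hgood.1.le
  exact absurd hω (not_le.2 (edist_bestRelabelling_lt hη hη' hσ))
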